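/- Let $P_1,\dots,P_n$ ($n\ge 3$, $P_{n+1}=P_1$) be the vertices, in cyclic order, of a simple closed polygonal line in the Euclidean plane $\mathbb R^2$ (the half-open edges $[P_i,P_{i+1})$ are non-degenerate and pairwise disjoint), and let $\Pi\subset\mathbb R^2$ be the polygonal region it bounds, that is, the bounded domain (non-empty connected open set) whose boundary is $\bigcup_{i=1}^n P_iP_{i+1}$. For $X\in\mathbb R^2$ put $$\Sigma_\Pi(X)=\int_{P\in\Pi}|P-X|\,dP,\qquad \Sigma_{P_iP_{i+1}}(X)=\int_{P\in P_iP_{i+1}}|P-X|\,dP,$$ where the first integral is with respect to area and the second with respect to arc length along the segment $P_iP_{i+1}$. Then a point $m\in\mathbb R^2$ is a geometric median of $\Pi$, i.e. $\Sigma_\Pi(m)\le\Sigma_\Pi(X)$ for all $X\in\mathbb R^2$, if and only if $$\sum_{i=1}^n \frac{\Sigma_{P_iP_{i+1}}(m)}{|P_{i+1}-P_i|}\,\overrightarrow{P_iP_{i+1}}=0 .$$ -/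

import Mathlib

open MeasureTheory

noncomputable section

/-- The Euclidean plane. -/
abbrev Plane : Type := EuclideanSpace ℝ (Fin 2)

/-- The polygon with vertices `P_1, …, P_n` (indices cyclic, `P_{n+1} = P_1`) is simple: its closed
boundary path has no self-intersections, that is, the half-open edges `[P_i, P_{i+1})` are traversed
injectively and are pairwise disjoint. (This forces `n = 0` or `n ≥ 3`.) -/
def Polygon.IsSimple {n : ℕ} (poly : Polygon Plane n) : Prop :=
  ∀ i j : Fin n, ∀ s ∈ Set.Ico (0 : ℝ) 1, ∀ t ∈ Set.Ico (0 : ℝ) 1,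
    poly.edgePath ℝ i s = poly.edgePath ℝ j t → i = j ∧ s = t

/-- `Ω` is the polygonal region with (cyclically ordered) vertices `P_1, …, P_n`: the bounded plane
domain whose boundary is the simple closed polygonal line `P_1 P_2 … P_n P_1`. -/
structure IsPolygonalRegion {n : ℕ} (Ω : Set Plane) (poly : Polygon Plane n) : Prop where
  simple : poly.IsSimple
  isOpen : IsOpen Ω
  connected : IsConnected Ω
  bounded : Bornology.IsBounded Ω
  frontier_eq : frontier Ω = poly.boundary ℝ

/-- `Σ_Ω(X) = ∫_{P ∈ Ω} |P - X| dP`, with respect to area. -/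
def regionDistIntegral (Ω : Set Plane) (X : Plane) : ℝ :=
  ∫ P in Ω, dist P X

/-- `m` is a geometric median of `Ω`: it minimizes `Σ_Ω` over the whole plane. -/
def IsGeometricMedian (Ω : Set Plane) (m : Plane) : Prop :=
  ∀ X : Plane, regionDistIntegral Ω m ≤ regionDistIntegral Ω X

/-- `Σ_{AB}(X) = ∫_{P ∈ AB} |P - X| dP`, with respect to arc length on the segment `AB`
parametrized by `P(t) = A + t (B - A)`, `0 ≤ t ≤ 1`, with speed `|B - A|`. -/
def segmentDistIntegral (A B X : Plane) : ℝ :=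
  ∫ t in (0 : ℝ)..1, dist (AffineMap.lineMap A B t) X * dist A B

end

/-!
The distance to `m` is convex in `m`, with gradient minus the unit vector from `m`, so `m` minimizes
`Σ_Ω` if and only if `∫_Ω ∇|P - m| dP = 0`. By the divergence theorem this integral is the sum over
the edges of the outward unit normal times `∫ |P - m| dP` along the edge, and a rotation by a right
angle turns the normals into the edge directions.

The divergence theorem is obtained by slicing. A function `f` with bounded support that is locally
constant off the polygon restricts to a step function on every line that misses the vertices, with
jumps at the points where the line crosses an edge. Integrating `f ∇φ` along the lines in a given
direction thus leaves the values of `φ` at the crossing points, weighted by the jumps of `f`. For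
the indicator function of `Ω` all edges have the same jump: the jumps along a line cancel, and
sweeping a line across a vertex exchanges the jumps of the two edges meeting there. The common jump
is nonzero because otherwise the divergence theorem for a linear `φ` would give `Ω` area zero.
-/

namespace PolygonMedian

open Filter Topology Set Bornology

section StepFunctions

variable {ι X α : Type*}

lemma exists_forall_eventually_nhdsNE_eq [TopologicalSpace X] [PreconnectedSpace X] [T1Space X]
    [Nonempty X] [∀ x : X, (𝓝[≠] x).NeBot] {g : X → α}
    (h : ∀ x, ∃ a, ∀ᶠ y in 𝓝[≠] x, g y = a) : ∃ a, ∀ x, ∀ᶠ y in 𝓝[≠] x, g y = a := by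
  choose a ha using h
  have hloc : IsLocallyConstant a := by
    rw [IsLocallyConstant.iff_eventually_eq]
    intro x
    filter_upwards [(eventually_nhdsWithin_iff.1 (ha x)).eventually_nhds] with y hy
    by_cases hxy : y = x
    · rw [hxy]
    have hyx : ∀ᶠ z in 𝓝[≠] y, z ≠ x :=
      (isOpen_ne.eventually_mem hxy).filter_mono nhdsWithin_le_nhds
    obtain ⟨z, hz, hzx, hzy⟩ := ((ha y).and (hyx.and (hy.filter_mono nhdsWithin_le_nhds))).exists
    rw [← hz, hzy hzx]
  obtain ⟨x₀⟩ := ‹Nonempty X›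
  exact ⟨a x₀, fun x => hloc.apply_eq_of_preconnectedSpace x x₀ ▸ ha x⟩

lemma eventually_indicator_Ioi_eq {x s : ℝ} (h : s ≠ x) :
    ∀ᶠ t in 𝓝 s, (Ioi x).indicator (1 : ℝ → ℝ) t = (Ioi x).indicator 1 s := by
  rcases h.lt_or_gt with h | h
  · filter_upwards [gt_mem_nhds h] with t ht
    rw [indicator_of_notMem (notMem_Ioi.2 (mem_Iio.1 ht).le),
      indicator_of_notMem (notMem_Ioi.2 h.le)]
  · filter_upwards [lt_mem_nhds h] with t ht
    rw [indicator_of_mem (mem_Ioi.2 ht), indicator_of_mem (mem_Ioi.2 h), Pi.one_apply, Pi.one_apply]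

/-- `g : ℝ → ℝ` is a step function: it is locally constant except at the distinct points `S i`,
`i ∈ T`, where it jumps by `a i`. The values of `g` at the jump points are not constrained. -/
structure HasJumps (g : ℝ → ℝ) (T : Finset ι) (S a : ι → ℝ) : Prop where
  injOn : InjOn S T
  eventually_eq : ∀ s ∉ S '' T, ∀ᶠ t in 𝓝 s, g t = g s
  jump : ∀ i ∈ T, ∃ b, (∀ᶠ s in 𝓝[<] S i, g s = b) ∧ ∀ᶠ s in 𝓝[>] S i, g s = b + a i

variable {g h ψ ψ' : ℝ → ℝ} {T : Finset ι} {S a b : ι → ℝ}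

namespace HasJumps

lemma sub (hg : HasJumps g T S a) (hh : HasJumps h T S b) : HasJumps (g - h) T S (a - b) where
  injOn := hg.injOn
  eventually_eq s hs := by
    filter_upwards [hg.eventually_eq s hs, hh.eventually_eq s hs] with t hgt hht
    rw [Pi.sub_apply, Pi.sub_apply, hgt, hht]
  jump i hi := by
    obtain ⟨x, hxl, hxr⟩ := hg.jump i hi
    obtain ⟨y, hyl, hyr⟩ := hh.jump i hi
    refine ⟨x - y, ?_, ?_⟩
    · filter_upwards [hxl, hyl] with t hx hy
      rw [Pi.sub_apply, hx, hy]
    · filter_upwards [hxr, hyr] with t hx hy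
      rw [Pi.sub_apply, Pi.sub_apply, hx, hy]
      ring

lemma sum_indicator (hS : InjOn S T) (a : ι → ℝ) :
    HasJumps (fun s => ∑ i ∈ T, a i * (Ioi (S i)).indicator 1 s) T S a where
  injOn := hS
  eventually_eq s hs := by
    have hstep : ∀ i ∈ T, ∀ᶠ t in 𝓝 s, (Ioi (S i)).indicator (1 : ℝ → ℝ) t =
        (Ioi (S i)).indicator 1 s :=
      fun i hi => eventually_indicator_Ioi_eq fun h => hs ⟨i, hi, h.symm⟩
    filter_upwards [(Finset.eventually_all T).2 hstep] with t ht
    exact Finset.sum_congr rfl fun i hi => by rw [ht i hi]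
  jump i hi := by
    classical
    have hrest : ∀ᶠ t in 𝓝 (S i), ∑ j ∈ T.erase i, a j * (Ioi (S j)).indicator 1 t =
        ∑ j ∈ T.erase i, a j * (Ioi (S j)).indicator 1 (S i) := by
      have hstep : ∀ j ∈ T.erase i, ∀ᶠ t in 𝓝 (S i), (Ioi (S j)).indicator (1 : ℝ → ℝ) t =
          (Ioi (S j)).indicator 1 (S i) := fun j hj => eventually_indicator_Ioi_eq fun h =>
        Finset.ne_of_mem_erase hj (hS (Finset.mem_of_mem_erase hj) hi h.symm)
      filter_upwards [(Finset.eventually_all _).2 hstep] with t ht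
      exact Finset.sum_congr rfl fun j hj => by rw [ht j hj]
    refine ⟨∑ j ∈ T.erase i, a j * (Ioi (S j)).indicator 1 (S i), ?_, ?_⟩
    · filter_upwards [hrest.filter_mono nhdsWithin_le_nhds, self_mem_nhdsWithin] with t ht hti
      rw [← Finset.sum_erase_add T _ hi, ht,
        indicator_of_notMem (notMem_Ioi.2 (mem_Iio.1 hti).le), mul_zero, add_zero]
    · filter_upwards [hrest.filter_mono nhdsWithin_le_nhds, self_mem_nhdsWithin] with t ht hti
      rw [← Finset.sum_erase_add T _ hi, ht, indicator_of_mem hti, Pi.one_apply, mul_one]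

lemma exists_eq_of_jump_eq_zero (hg : HasJumps g T S 0) : ∃ c, ∀ s ∉ S '' T, g s = c := by
  obtain ⟨c, hc⟩ : ∃ c, ∀ s, ∀ᶠ t in 𝓝[≠] s, g t = c := by
    refine exists_forall_eventually_nhdsNE_eq fun s => ?_
    by_cases hs : s ∈ S '' T
    · obtain ⟨i, hi, rfl⟩ := hs
      obtain ⟨b, hl, hr⟩ := hg.jump i hi
      rw [Pi.zero_apply, add_zero] at hr
      exact ⟨b, nhdsLT_sup_nhdsGT (S i) ▸ eventually_sup.2 ⟨hl, hr⟩⟩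
    · exact ⟨g s, (hg.eventually_eq s hs).filter_mono nhdsWithin_le_nhds⟩
  refine ⟨c, fun s hs => ?_⟩
  obtain ⟨t, hts, htc⟩ :=
    (((hg.eventually_eq s hs).filter_mono nhdsWithin_le_nhds).and (hc s)).exists
  exact hts.symm.trans htc

lemma eq_sum_indicator (hg : HasJumps g T S a) (h0 : ∀ᶠ s in atBot, g s = 0) {s : ℝ}
    (hs : s ∉ S '' T) : g s = ∑ i ∈ T, a i * (Ioi (S i)).indicator 1 s := by
  have hdiff := hg.sub (sum_indicator hg.injOn a)
  rw [sub_self] at hdiff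
  obtain ⟨c, hc⟩ := hdiff.exists_eq_of_jump_eq_zero
  have hleft : ∀ᶠ t in atBot, ∀ i ∈ T, t < S i :=
    (Finset.eventually_all T).2 fun i _ => eventually_lt_atBot (S i)
  obtain ⟨t, ht0, ht⟩ := (h0.and hleft).exists
  have hct : 0 = c := by
    rw [← hc t fun ⟨i, hi, h⟩ => (ht i hi).ne h.symm, Pi.sub_apply, ht0, zero_sub, zero_eq_neg]
    exact Finset.sum_eq_zero fun i hi => by
      rw [indicator_of_notMem (notMem_Ioi.2 (ht i hi).le), mul_zero]
  exact sub_eq_zero.1 (hct ▸ hc s hs)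

lemma sum_eq_zero (hg : HasJumps g T S a) (h0 : ∀ᶠ s in cobounded ℝ, g s = 0) :
    ∑ i ∈ T, a i = 0 := by
  have hright : ∀ᶠ s in atTop, ∀ i ∈ T, S i < s :=
    (Finset.eventually_all T).2 fun i _ => eventually_gt_atTop (S i)
  obtain ⟨s, hs0, hs⟩ := ((h0.filter_mono IsOrderBornology.atTop_le_cobounded).and hright).exists
  have hsum := hg.eq_sum_indicator (h0.filter_mono IsOrderBornology.atBot_le_cobounded)
    fun ⟨i, hi, h⟩ => (hs i hi).ne h
  rw [← hs0, hsum]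
  exact Finset.sum_congr rfl fun i hi => by
    rw [indicator_of_mem (mem_Ioi.2 (hs i hi)), Pi.one_apply, mul_one]

lemma integral_mul_deriv (hg : HasJumps g T S a) (h0 : ∀ᶠ s in cobounded ℝ, g s = 0)
    (hψ : ∀ s, HasDerivAt ψ (ψ' s) s) (hψ' : Continuous ψ') :
    ∫ s, g s * ψ' s = -∑ i ∈ T, a i * ψ (S i) := by
  have hright : ∀ᶠ s in atTop, ∀ i ∈ T, S i ≤ s :=
    (Finset.eventually_all T).2 fun i _ => eventually_ge_atTop (S i)
  obtain ⟨R, hR0, hR⟩ :=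
    ((eventually_forall_ge_atTop.2 (h0.filter_mono IsOrderBornology.atTop_le_cobounded)).and
      hright).exists
  have hae : (fun s => g s * ψ' s) =ᵐ[volume]
      fun s => ∑ i ∈ T, a i * (Ioc (S i) R).indicator ψ' s := by
    have hfin : (S '' T).Finite := T.finite_toSet.image S
    filter_upwards [compl_mem_ae_iff.2 (hfin.measure_zero volume)] with s hs
    rcases le_or_gt s R with hsR | hRs
    · rw [hg.eq_sum_indicator (h0.filter_mono IsOrderBornology.atBot_le_cobounded) hs,
        Finset.sum_mul]
      refine Finset.sum_congr rfl fun i _ => ?_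
      by_cases hi : S i < s <;> simp [hi, hsR]
    · simp [hR0 s hRs.le, hRs]
  have hint : ∀ i ∈ T, ∫ s, (Ioc (S i) R).indicator ψ' s = ψ R - ψ (S i) := fun i hi => by
    rw [integral_indicator measurableSet_Ioc, ← intervalIntegral.integral_of_le (hR i hi)]
    exact intervalIntegral.integral_eq_sub_of_hasDerivAt (fun s _ => hψ s)
      (hψ'.intervalIntegrable _ _)
  calc ∫ s, g s * ψ' s = ∑ i ∈ T, a i * (ψ R - ψ (S i)) := by
        rw [integral_congr_ae hae, integral_finsetSum T fun i _ =>
          ((hψ'.integrableOn_Ioc).integrable_indicator measurableSet_Ioc).const_mul _]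
        exact Finset.sum_congr rfl fun i hi => by rw [integral_const_mul, hint i hi]
    _ = -∑ i ∈ T, a i * ψ (S i) := by
        simp only [mul_sub, Finset.sum_sub_distrib, ← Finset.sum_mul, hg.sum_eq_zero h0, zero_mul,
          zero_sub]

end HasJumps

lemma eq_zero_of_sum_indicator_Ioi_eq_zero [Fintype ι] (hS : Function.Injective S)
    (h : ∀ s ∉ range S, ∑ i, a i * (Ioi (S i)).indicator 1 s = 0) (i : ι) : a i = 0 := by
  obtain ⟨b, hl, hr⟩ := (HasJumps.sum_indicator (T := Finset.univ) hS.injOn a).jump i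
    (Finset.mem_univ i)
  have h0 : ∀ᶠ s in 𝓝[≠] S i, ∑ j, a j * (Ioi (S j)).indicator 1 s = 0 :=
    ((finite_range S).eventually_cofinite_notMem.filter_mono (nhdsNE_le_cofinite _)).mono h
  rw [← nhdsLT_sup_nhdsGT, eventually_sup] at h0
  obtain ⟨s, hs0, hsb⟩ := (h0.1.and hl).exists
  obtain ⟨t, ht0, htb⟩ := (h0.2.and hr).exists
  linarith

lemma indicator_Ioi_sub_mul (k : ℝ → ℝ) (a b s : ℝ) :
    ((Ioi b).indicator 1 s - (Ioi a).indicator 1 s) * k s =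
      (Ioc b a).indicator k s - (Ioc a b).indicator k s := by
  by_cases ha : a < s <;> by_cases hb : b < s <;> simp [indicator, ha, hb, not_le.2, le_of_not_gt]

lemma integrable_indicator_Ioi_sub_mul {k : ℝ → ℝ} (hk : Continuous k) (a b : ℝ) :
    Integrable fun s => ((Ioi b).indicator 1 s - (Ioi a).indicator 1 s) * k s := by
  simp only [indicator_Ioi_sub_mul]
  exact (hk.integrableOn_Ioc.integrable_indicator measurableSet_Ioc).sub
    (hk.integrableOn_Ioc.integrable_indicator measurableSet_Ioc)

lemma integral_indicator_Ioi_sub_mul {k : ℝ → ℝ} (hk : Continuous k) (a b : ℝ) :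
    ∫ s, ((Ioi b).indicator 1 s - (Ioi a).indicator 1 s) * k s = ∫ s in b..a, k s := by
  simp only [indicator_Ioi_sub_mul]
  rw [integral_sub (hk.integrableOn_Ioc.integrable_indicator measurableSet_Ioc)
    (hk.integrableOn_Ioc.integrable_indicator measurableSet_Ioc),
    integral_indicator measurableSet_Ioc, integral_indicator measurableSet_Ioc, intervalIntegral]

end StepFunctions

section Edges

variable {E : Type*} [AddCommGroup E] [Module ℝ E] {n : ℕ}

/-- The vector along the `i`-th edge of a polygon. -/
def edgeVec (poly : Polygon E n) (i : Fin n) : E := poly (finRotate n i) - poly i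

variable (poly : Polygon E n) (i : Fin n)

lemma edgePath_eq (t : ℝ) : poly.edgePath ℝ i t = poly i + t • edgeVec poly i := by
  simp [Polygon.edgePath, AffineMap.lineMap_apply, edgeVec, add_comm]

lemma edgePath_zero : poly.edgePath ℝ i 0 = poly i := by
  simp [edgePath_eq]

lemma edgePath_one : poly.edgePath ℝ i 1 = poly (finRotate n i) := by
  simp [edgePath_eq, edgeVec]

variable {poly} in
lemma mem_boundary_iff {x : E} : x ∈ poly.boundary ℝ ↔ ∃ i, x ∈ poly.edgeSet ℝ i :=
  mem_iUnion

variable [TopologicalSpace E] [IsTopologicalAddGroup E] [ContinuousSMul ℝ E]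

lemma continuous_edgePath : Continuous (poly.edgePath ℝ i) :=
  AffineMap.lineMap_continuous

lemma isCompact_edgeSet : IsCompact (poly.edgeSet ℝ i) :=
  isCompact_Icc.image (continuous_edgePath poly i)

lemma eventually_add_smul_mem {U : Set E} (hU : IsOpen U) {x : E} (hx : x ∈ U) (u : E) :
    ∀ᶠ r in 𝓝[>] (0 : ℝ), x + r • u ∈ U := by
  have hcont : Continuous fun r : ℝ => x + r • u := by fun_prop
  exact nhdsWithin_le_nhds ((hU.preimage hcont).mem_nhds (by simpa using hx))

end Edges

section SimplePolygons

open scoped EuclideanSpace RealInnerProductSpace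

variable {n : ℕ} {poly : Polygon Plane n} {i j : Fin n} {s t : ℝ}

lemma edgeVec_ne_zero (hs : poly.IsSimple) (i : Fin n) : edgeVec poly i ≠ 0 := by
  intro h
  have h12 := hs i i 0 (by simp) (1 / 2) (by norm_num) (by simp [edgePath_eq, h])
  norm_num at h12

lemma vertices_injective (hs : poly.IsSimple) : Function.Injective poly.vertices :=
  fun i j h => (hs i j 0 (by simp) 0 (by simp) (by simpa only [edgePath_zero] using h)).1

lemma eq_of_edgePath_mem_edgeSet (hs : poly.IsSimple) (ht : t ∈ Ioo (0 : ℝ) 1)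
    (h : poly.edgePath ℝ i t ∈ poly.edgeSet ℝ j) : i = j := by
  obtain ⟨r, hr, hrt⟩ := h
  change poly.edgePath ℝ j r = _ at hrt
  rcases hr.2.lt_or_eq with hr1 | rfl
  · exact (hs i j t ⟨ht.1.le, ht.2⟩ r ⟨hr.1, hr1⟩ hrt.symm).1
  · rw [edgePath_one, ← edgePath_zero] at hrt
    exact absurd (hs i _ t ⟨ht.1.le, ht.2⟩ 0 (by simp) hrt.symm).2 ht.1.ne'

lemma exists_isOpen_convex_inter_boundary_subset_edgeSet (hs : poly.IsSimple) (i : Fin n)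
    (hs01 : s ∈ Ioo (0 : ℝ) 1) (ht01 : t ∈ Ioo (0 : ℝ) 1) :
    ∃ U : Set Plane, IsOpen U ∧ Convex ℝ U ∧ poly.edgePath ℝ i s ∈ U ∧ poly.edgePath ℝ i t ∈ U ∧
      U ∩ poly.boundary ℝ ⊆ poly.edgeSet ℝ i := by
  set K := poly.edgePath ℝ i '' uIcc s t
  have hK : IsCompact K := isCompact_uIcc.image (continuous_edgePath poly i)
  have hothers : IsClosed (⋃ j ∈ {j | j ≠ i}, poly.edgeSet ℝ j) :=
    (toFinite _).isClosed_biUnion fun j _ => (isCompact_edgeSet poly j).isClosed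
  have hKothers : K ⊆ (⋃ j ∈ {j | j ≠ i}, poly.edgeSet ℝ j)ᶜ := by
    rintro _ ⟨r, hr, rfl⟩ hmem
    obtain ⟨j, hji, hj⟩ := mem_iUnion₂.1 hmem
    exact hji (eq_of_edgePath_mem_edgeSet hs (ordConnected_Ioo.uIcc_subset hs01 ht01 hr) hj).symm
  obtain ⟨δ, hδ, hsub⟩ := hK.exists_thickening_subset_open hothers.isOpen_compl hKothers
  have hself := Metric.self_subset_thickening hδ K
  refine ⟨Metric.thickening δ K, Metric.isOpen_thickening,
    ((convex_uIcc s t).affine_image _).thickening δ, hself (mem_image_of_mem _ left_mem_uIcc),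
    hself (mem_image_of_mem _ right_mem_uIcc), ?_⟩
  rintro x ⟨hxU, hx⟩
  obtain ⟨j, hj⟩ := mem_boundary_iff.1 hx
  by_contra hxi
  exact hsub hxU (mem_iUnion₂.2 ⟨j, fun h => hxi (h ▸ hj), hj⟩)

/-- `f` has bounded support and is locally constant off the boundary of `poly`. -/
structure IsPiecewiseConstant (f : Plane → ℝ) (poly : Polygon Plane n) : Prop where
  eventually_eq : ∀ x ∉ poly.boundary ℝ, ∀ᶠ y in 𝓝 x, f y = f x
  eventually_eq_zero : ∀ᶠ x in cobounded Plane, f x = 0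

lemma IsPiecewiseConstant.eq_of_isPreconnected {f : Plane → ℝ} (hf : IsPiecewiseConstant f poly)
    {A : Set Plane} (hA : IsPreconnected A) (hAb : Disjoint A (poly.boundary ℝ)) {x y : Plane}
    (hx : x ∈ A) (hy : y ∈ A) : f x = f y :=
  hA.induction₂ (fun x y => f x = f y)
    (fun x hx => ((hf.eventually_eq x (disjoint_left.1 hAb hx)).filter_mono
      nhdsWithin_le_nhds).mono fun _ => Eq.symm)
    (fun _ _ _ _ _ _ => Eq.trans) (fun _ _ _ _ => Eq.symm) hx hy

/-- The value of `f` near the midpoint of the `i`-th edge, on the side that `u` points to. It is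
meaningful when `f` is locally constant off the edges and `u` is transversal to the edge. -/
noncomputable def edgeTrace (f : Plane → ℝ) (poly : Polygon Plane n) (i : Fin n) (u : Plane) : ℝ :=
  limUnder (𝓝[>] 0) fun r : ℝ => f (poly.edgePath ℝ i (1 / 2) + r • u)

variable (o : Orientation ℝ Plane (Fin 2)) {f : Plane → ℝ} {u v w : Plane}

local notation "ω" => o.areaForm
local notation "J" => o.rightAngleRotation

/-- The jump of `f` across the `i`-th edge: the trace on the left minus the trace on the right. -/
noncomputable def edgeJump (f : Plane → ℝ) (poly : Polygon Plane n) (i : Fin n) : ℝ :=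
  edgeTrace f poly i (J (edgeVec poly i)) - edgeTrace f poly i (-J (edgeVec poly i))

namespace IsPiecewiseConstant

lemma exists_eventually_eq_of_same_side (hf : IsPiecewiseConstant f poly) (hs : poly.IsSimple)
    (hs01 : s ∈ Ioo (0 : ℝ) 1) (ht01 : t ∈ Ioo (0 : ℝ) 1)
    (huw : 0 < ω (edgeVec poly i) u * ω (edgeVec poly i) w) :
    ∃ a, (∀ᶠ r in 𝓝[>] (0 : ℝ), f (poly.edgePath ℝ i s + r • u) = a) ∧
      ∀ᶠ r in 𝓝[>] (0 : ℝ), f (poly.edgePath ℝ i t + r • w) = a := by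
  obtain ⟨U, hU, hUc, hsU, htU, hUb⟩ :=
    exists_isOpen_convex_inter_boundary_subset_edgeSet hs i hs01 ht01
  set side : Plane →ₗ[ℝ] ℝ := ω (edgeVec poly i) u • ω (edgeVec poly i)
  have hside : ∀ r z, side (poly.edgePath ℝ i r + z) = side (poly i) + side z := fun r z => by
    simp [side, edgePath_eq, mul_add]
  set A := U ∩ {x | side (poly i) < side x}
  have hA : IsPreconnected A := (hUc.inter (convex_halfSpace_gt side.isLinear _)).isPreconnected
  have hAb : Disjoint A (poly.boundary ℝ) := by
    refine disjoint_left.2 fun x hx hxb => ?_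
    obtain ⟨r, -, rfl⟩ := hUb ⟨hx.1, hxb⟩
    have hr := hside r 0
    rw [add_zero, map_zero, add_zero] at hr
    exact hx.2.ne' hr
  have hmem : ∀ r z, poly.edgePath ℝ i r ∈ U → 0 < side z →
      ∀ᶠ ρ in 𝓝[>] (0 : ℝ), poly.edgePath ℝ i r + ρ • z ∈ A := fun r z hr hz => by
    filter_upwards [eventually_add_smul_mem hU hr z, self_mem_nhdsWithin] with ρ hρU hρ
    refine ⟨hρU, ?_⟩
    rw [mem_ofPred_eq, hside, map_smul, smul_eq_mul, lt_add_iff_pos_right]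
    exact mul_pos hρ hz
  have hu := hmem s u hsU (mul_self_pos.2 (left_ne_zero_of_mul huw.ne'))
  have hw := hmem t w htU huw
  obtain ⟨ρ, hρ⟩ := hu.exists
  exact ⟨_, hu.mono fun r hr => hf.eq_of_isPreconnected hA hAb hr hρ,
    hw.mono fun r hr => hf.eq_of_isPreconnected hA hAb hr hρ⟩

lemma eventually_eq_edgeTrace (hf : IsPiecewiseConstant f poly) (hs : poly.IsSimple)
    (ht01 : t ∈ Ioo (0 : ℝ) 1) (huw : 0 < ω (edgeVec poly i) u * ω (edgeVec poly i) w) :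
    ∀ᶠ r in 𝓝[>] (0 : ℝ), f (poly.edgePath ℝ i t + r • u) = edgeTrace f poly i w := by
  obtain ⟨a, hu, hw⟩ := hf.exists_eventually_eq_of_same_side o hs ht01
    (show (1 / 2 : ℝ) ∈ Ioo 0 1 by norm_num) huw
  have htrace : edgeTrace f poly i w = a :=
    (tendsto_const_nhds.congr' (hw.mono fun _ => Eq.symm)).limUnder_eq
  rwa [htrace]

lemma exists_jump_of_transversal (hf : IsPiecewiseConstant f poly) (hs : poly.IsSimple)
    (ht01 : t ∈ Ioo (0 : ℝ) 1) (hv : ω (edgeVec poly i) v ≠ 0) :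
    ∃ b, (∀ᶠ r in 𝓝[>] (0 : ℝ), f (poly.edgePath ℝ i t + r • -v) = b) ∧
      ∀ᶠ r in 𝓝[>] (0 : ℝ), f (poly.edgePath ℝ i t + r • v) =
        b + Real.sign (ω (edgeVec poly i) v) * edgeJump o f poly i := by
  have hJ : 0 < ω (edgeVec poly i) (J (edgeVec poly i)) := by
    rw [o.areaForm_rightAngleRotation_right]
    exact real_inner_self_pos.2 (edgeVec_ne_zero hs i)
  rcases hv.lt_or_gt with hv | hv
  · refine ⟨edgeTrace f poly i (J (edgeVec poly i)), hf.eventually_eq_edgeTrace o hs ht01 ?_, ?_⟩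
    · rw [map_neg]
      exact mul_pos (neg_pos.2 hv) hJ
    · rw [Real.sign_of_neg hv, edgeJump, neg_one_mul, neg_sub, add_sub_cancel]
      refine hf.eventually_eq_edgeTrace o hs ht01 ?_
      rw [map_neg]
      exact mul_pos_of_neg_of_neg hv (neg_neg_of_pos hJ)
  · refine ⟨edgeTrace f poly i (-J (edgeVec poly i)), hf.eventually_eq_edgeTrace o hs ht01 ?_, ?_⟩
    · rw [map_neg, map_neg, neg_mul_neg]
      exact mul_pos hv hJ
    · rw [Real.sign_of_pos hv, edgeJump, one_mul, add_sub_cancel]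
      exact hf.eventually_eq_edgeTrace o hs ht01 (mul_pos hv hJ)

end IsPiecewiseConstant

end SimplePolygons

section Lines

open scoped EuclideanSpace RealInnerProductSpace

variable {n : ℕ} {poly : Polygon Plane n} {i : Fin n} {f φ : Plane → ℝ} {G : Plane → Plane}
  (o : Orientation ℝ Plane (Fin 2)) {v x y : Plane} {c s t : ℝ}

local notation "ω" => o.areaForm
local notation "J" => o.rightAngleRotation

lemma areaForm_smul_add_smul (hv : ‖v‖ = 1) (s c : ℝ) : ω v (s • v + c • J v) = c := by
  simp [hv]

lemma inner_smul_add_smul (hv : ‖v‖ = 1) (s c : ℝ) : ⟪v, s • v + c • J v⟫ = s := by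
  simp [inner_add_right, inner_smul_right, hv]

lemma inner_smul_add_areaForm_smul (hv : ‖v‖ = 1) (x : Plane) :
    ⟪v, x⟫ • v + ω v x • J v = x := by
  refine ext_inner_left ℝ fun y => ?_
  have h := o.inner_mul_inner_add_areaForm_mul_areaForm v y x
  rw [hv, one_pow, one_mul] at h
  rw [inner_add_right, inner_smul_right, inner_smul_right, o.inner_rightAngleRotation_right,
    ← o.areaForm_swap, real_inner_comm v y, ← h]
  ring

lemma eq_of_inner_eq_of_areaForm_eq (hv : ‖v‖ = 1) (hi : ⟪v, x⟫ = ⟪v, y⟫) (ha : ω v x = ω v y) :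
    x = y := by
  rw [← inner_smul_add_areaForm_smul o hv x, hi, ha, inner_smul_add_areaForm_smul o hv y]

lemma areaForm_edgeVec (v : Plane) (i : Fin n) :
    ω v (edgeVec poly i) = ω v (poly (finRotate n i)) - ω v (poly i) :=
  map_sub _ _ _

lemma areaForm_edgePath (v : Plane) (i : Fin n) (t : ℝ) :
    ω v (poly.edgePath ℝ i t) = ω v (poly i) + t * ω v (edgeVec poly i) := by
  rw [edgePath_eq, map_add, map_smul, smul_eq_mul]

/-- The sign with which the `i`-th edge crosses the line at height `c` in direction `v`, that is,
`{x | ω v x = c}`: it is `1` if the edge passes to lower heights, `-1` if it passes to greater ones,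
and `0` if it stays on one side. -/
noncomputable def crossingSign (poly : Polygon Plane n) (v : Plane) (c : ℝ) (i : Fin n) : ℝ :=
  (Ioi (ω v (poly (finRotate n i)))).indicator 1 c - (Ioi (ω v (poly i))).indicator 1 c

/-- The parameter at which the line through the `i`-th edge meets the line `{x | ω v x = c}`; it is
meaningful when the `i`-th edge is not parallel to `v`. -/
noncomputable def crossingParam (poly : Polygon Plane n) (v : Plane) (c : ℝ) (i : Fin n) : ℝ :=
  (c - ω v (poly i)) / ω v (edgeVec poly i)

/-- The point where the line through the `i`-th edge meets the line `{x | ω v x = c}`. -/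
noncomputable def crossingPoint (poly : Polygon Plane n) (v : Plane) (c : ℝ) (i : Fin n) : Plane :=
  poly.edgePath ℝ i (crossingParam o poly v c i)

lemma crossingSign_cases (hc : c ∉ range fun i => ω v (poly i))
    (hi : crossingSign o poly v c i ≠ 0) :
    (crossingSign o poly v c i = 1 ∧ ω v (poly (finRotate n i)) < c ∧ c < ω v (poly i)) ∨
      (crossingSign o poly v c i = -1 ∧ ω v (poly i) < c ∧ c < ω v (poly (finRotate n i))) := by
  have ha : ω v (poly i) ≠ c := fun h => hc ⟨i, h⟩
  have hb : ω v (poly (finRotate n i)) ≠ c := fun h => hc ⟨finRotate n i, h⟩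
  unfold crossingSign at hi ⊢
  generalize ω v (poly i) = a, ω v (poly (finRotate n i)) = b at ha hb hi ⊢
  rcases ha.lt_or_gt with ha | ha <;> rcases hb.lt_or_gt with hb | hb <;>
    simp_all [le_of_lt]

lemma areaForm_edgeVec_ne_zero_of_crossingSign_ne_zero (hc : c ∉ range fun i => ω v (poly i))
    (hi : crossingSign o poly v c i ≠ 0) : ω v (edgeVec poly i) ≠ 0 := by
  rw [areaForm_edgeVec]
  rcases crossingSign_cases o hc hi with ⟨-, h, h'⟩ | ⟨-, h, h'⟩
  · exact (sub_neg.2 (h.trans h')).ne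
  · exact (sub_pos.2 (h.trans h')).ne'

lemma crossingSign_eq_sign (hc : c ∉ range fun i => ω v (poly i))
    (hi : crossingSign o poly v c i ≠ 0) :
    crossingSign o poly v c i = Real.sign (ω (edgeVec poly i) v) := by
  rw [o.areaForm_swap, areaForm_edgeVec]
  rcases crossingSign_cases o hc hi with ⟨h1, h, h'⟩ | ⟨h1, h, h'⟩
  · rw [h1, Real.sign_of_pos (by linarith)]
  · rw [h1, Real.sign_of_neg (by linarith)]

lemma crossingParam_mem_Ioo (hc : c ∉ range fun i => ω v (poly i))
    (hi : crossingSign o poly v c i ≠ 0) : crossingParam o poly v c i ∈ Ioo (0 : ℝ) 1 := by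
  rw [crossingParam, areaForm_edgeVec]
  rcases crossingSign_cases o hc hi with ⟨-, h, h'⟩ | ⟨-, h, h'⟩
  · exact ⟨div_pos_of_neg_of_neg (by linarith) (by linarith),
      (div_lt_one_of_neg (by linarith)).2 (by linarith)⟩
  · exact ⟨div_pos (by linarith) (by linarith), (div_lt_one (by linarith)).2 (by linarith)⟩

lemma areaForm_crossingPoint (hi : ω v (edgeVec poly i) ≠ 0) :
    ω v (crossingPoint o poly v c i) = c := by
  rw [crossingPoint, areaForm_edgePath, crossingParam, div_mul_cancel₀ _ hi, add_sub_cancel]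

lemma inner_smul_add_crossingPoint (hv : ‖v‖ = 1) (hi : ω v (edgeVec poly i) ≠ 0) :
    ⟪v, crossingPoint o poly v c i⟫ • v + c • J v = crossingPoint o poly v c i := by
  simpa only [areaForm_crossingPoint o hi] using
    inner_smul_add_areaForm_smul o hv (crossingPoint o poly v c i)

lemma crossingSign_ne_zero_and_crossingParam_eq (hc : c ∉ range fun i => ω v (poly i))
    (ht : t ∈ Icc (0 : ℝ) 1) (h : ω v (poly.edgePath ℝ i t) = c) :
    crossingSign o poly v c i ≠ 0 ∧ crossingParam o poly v c i = t := by
  have ha : ω v (poly i) ≠ c := fun h => hc ⟨i, h⟩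
  have hb : ω v (poly (finRotate n i)) ≠ c := fun h => hc ⟨finRotate n i, h⟩
  rw [areaForm_edgePath, areaForm_edgeVec] at h
  unfold crossingSign crossingParam
  rw [areaForm_edgeVec]
  generalize ω v (poly i) = a, ω v (poly (finRotate n i)) = b at ha hb h ⊢
  rcases ha.lt_or_gt with ha | ha
  · have hab : a < b := lt_of_not_ge fun hba => by nlinarith [mul_nonneg ht.1 (sub_nonneg.2 hba)]
    have hb : c < b := lt_of_le_of_ne (by nlinarith [ht.2]) hb.symm
    rw [indicator_of_notMem (notMem_Ioi.2 hb.le), indicator_of_mem (mem_Ioi.2 ha),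
      div_eq_iff (by linarith)]
    exact ⟨by norm_num, by linarith⟩
  · have hba : b < a := lt_of_not_ge fun hab => by nlinarith [mul_nonneg ht.1 (sub_nonneg.2 hab)]
    have hb : b < c := lt_of_le_of_ne (by nlinarith [ht.2]) hb
    rw [indicator_of_notMem (notMem_Ioi.2 ha.le), indicator_of_mem (mem_Ioi.2 hb),
      div_eq_iff (by linarith)]
    exact ⟨by norm_num, by linarith⟩

lemma exists_crossing_of_line_mem_boundary (hv : ‖v‖ = 1) (hc : c ∉ range fun i => ω v (poly i))
    (hmem : s • v + c • J v ∈ poly.boundary ℝ) :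
    ∃ i, crossingSign o poly v c i ≠ 0 ∧ ⟪v, crossingPoint o poly v c i⟫ = s := by
  obtain ⟨i, t, ht, hti⟩ := mem_boundary_iff.1 hmem
  change poly.edgePath ℝ i t = _ at hti
  obtain ⟨hi, rfl⟩ := crossingSign_ne_zero_and_crossingParam_eq o hc ht
    (by rw [hti, areaForm_smul_add_smul o hv])
  exact ⟨i, hi, by rw [crossingPoint, hti, inner_smul_add_smul o hv]⟩

namespace IsPiecewiseConstant

lemma hasJumps_line (hf : IsPiecewiseConstant f poly) (hs : poly.IsSimple) (hv : ‖v‖ = 1)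
    (hc : c ∉ range fun i => ω v (poly i)) :
    HasJumps (fun s : ℝ => f (s • v + c • J v)) {i | crossingSign o poly v c i ≠ 0}
      (fun i => ⟪v, crossingPoint o poly v c i⟫)
      fun i => crossingSign o poly v c i * edgeJump o f poly i := by
  have hheight : ∀ i, crossingSign o poly v c i ≠ 0 → ω v (crossingPoint o poly v c i) = c :=
    fun i hi => areaForm_crossingPoint o (areaForm_edgeVec_ne_zero_of_crossingSign_ne_zero o hc hi)
  refine ⟨fun i hi j hj hij => ?_, fun s hsS => ?_, fun i hi => ?_⟩
  · simp only [Finset.coe_filter, Finset.mem_univ, true_and, mem_ofPred_eq] at hi hj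
    refine eq_of_edgePath_mem_edgeSet hs (crossingParam_mem_Ioo o hc hi)
      ⟨_, Ioo_subset_Icc_self (crossingParam_mem_Ioo o hc hj), ?_⟩
    exact eq_of_inner_eq_of_areaForm_eq o hv hij.symm ((hheight j hj).trans (hheight i hi).symm)
  · have hline : s • v + c • J v ∉ poly.boundary ℝ := fun hmem => by
      obtain ⟨i, hi, his⟩ := exists_crossing_of_line_mem_boundary o hv hc hmem
      exact hsS ⟨i, by simpa using hi, his⟩
    have hcont : Continuous fun s : ℝ => s • v + c • J v := by fun_prop
    exact (hcont.tendsto s).eventually (hf.eventually_eq _ hline)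
  · replace hi : crossingSign o poly v c i ≠ 0 := by simpa using hi
    have hline : ∀ s : ℝ, s • v + c • J v =
        crossingPoint o poly v c i + (s - ⟪v, crossingPoint o poly v c i⟫) • v := fun s => by
      linear_combination (norm := module) inner_smul_add_crossingPoint o (c := c) hv
        (areaForm_edgeVec_ne_zero_of_crossingSign_ne_zero o hc hi)
    have hev : ω (edgeVec poly i) v ≠ 0 := by
      rw [o.areaForm_swap]
      exact neg_ne_zero.2 (areaForm_edgeVec_ne_zero_of_crossingSign_ne_zero o hc hi)
    obtain ⟨b, hb, hb'⟩ := hf.exists_jump_of_transversal o hs (crossingParam_mem_Ioo o hc hi) hev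
    rw [← crossingSign_eq_sign o hc hi] at hb'
    refine ⟨b, ?_, ?_⟩
    · rw [← sub_self ⟪v, crossingPoint o poly v c i⟫, ← map_subLeft_nhdsLT, eventually_map] at hb
      filter_upwards [hb] with s hs
      rwa [hline, ← neg_sub, neg_smul, ← smul_neg]
    · rw [← sub_self ⟪v, crossingPoint o poly v c i⟫, ← map_subRight_nhdsGT, eventually_map] at hb'
      filter_upwards [hb'] with s hs
      rwa [hline]

lemma eventually_line_eq_zero (hf : IsPiecewiseConstant f poly) (hv : ‖v‖ = 1) (c : ℝ) :
    ∀ᶠ s : ℝ in cobounded ℝ, f (s • v + c • J v) = 0 := by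
  have hline : Isometry fun s : ℝ => s • v + c • J v :=
    Isometry.of_dist_eq fun s t => by
      rw [dist_add_right, dist_eq_norm, ← sub_smul, norm_smul, hv, mul_one, dist_eq_norm]
  exact hline.antilipschitz.tendsto_cobounded.eventually hf.eventually_eq_zero

lemma sum_crossingSign_mul_edgeJump (hf : IsPiecewiseConstant f poly) (hs : poly.IsSimple)
    (hv : ‖v‖ = 1) (hc : c ∉ range fun i => ω v (poly i)) :
    ∑ i, crossingSign o poly v c i * edgeJump o f poly i = 0 := by
  rw [← (hf.hasJumps_line o hs hv hc).sum_eq_zero (hf.eventually_line_eq_zero o hv c)]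
  exact (Finset.sum_filter_of_ne fun i _ => left_ne_zero_of_mul).symm

lemma integral_line_mul_inner_gradient (hf : IsPiecewiseConstant f poly) (hs : poly.IsSimple)
    (hv : ‖v‖ = 1) (hc : c ∉ range fun i => ω v (poly i))
    (hφ : ∀ s : ℝ, HasGradientAt φ (G (s • v + c • J v)) (s • v + c • J v))
    (hG : ∀ s : ℝ, ContinuousAt G (s • v + c • J v)) :
    ∫ s : ℝ, f (s • v + c • J v) * ⟪v, G (s • v + c • J v)⟫ =
      -∑ i, crossingSign o poly v c i * edgeJump o f poly i * φ (crossingPoint o poly v c i) := by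
  have hderiv : ∀ s : ℝ, HasDerivAt (fun s : ℝ => φ (s • v + c • J v))
      ⟪v, G (s • v + c • J v)⟫ s := fun s => by
    have hline : HasDerivAt (fun s : ℝ => s • v + c • J v) v s := by
      simpa using ((hasDerivAt_id s).smul_const v).add_const (c • J v)
    simpa [real_inner_comm, Function.comp_def] using (hφ s).hasFDerivAt.comp_hasDerivAt s hline
  have hcont : Continuous fun s : ℝ => ⟪v, G (s • v + c • J v)⟫ :=
    continuous_const.inner (continuous_iff_continuousAt.2 fun s =>
      (hG s).comp (f := fun s : ℝ => s • v + c • J v) (by fun_prop))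
  rw [(hf.hasJumps_line o hs hv hc).integral_mul_deriv (hf.eventually_line_eq_zero o hv c) hderiv
    hcont, neg_inj, ← Finset.sum_filter_of_ne (s := Finset.univ)
    (p := fun i => crossingSign o poly v c i ≠ 0)
    fun i _ h => left_ne_zero_of_mul (left_ne_zero_of_mul h)]
  refine Finset.sum_congr rfl fun i hi => ?_
  rw [inner_smul_add_crossingPoint o hv
    (areaForm_edgeVec_ne_zero_of_crossingSign_ne_zero o hc (by simpa using hi))]

end IsPiecewiseConstant

end Lines

section Jumps

open scoped EuclideanSpace RealInnerProductSpace

variable {n : ℕ} {poly : Polygon Plane n} {f : Plane → ℝ} (o : Orientation ℝ Plane (Fin 2))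

local notation "ω" => o.areaForm
local notation "J" => o.rightAngleRotation

lemma exists_norm_eq_one_injective_areaForm {ι : Type*} [Finite ι] {P : ι → Plane}
    (hP : Function.Injective P) : ∃ v : Plane, ‖v‖ = 1 ∧ Function.Injective fun i => ω v (P i) := by
  obtain ⟨ℓ, hℓ⟩ := Module.exists_dual_forall_apply_ne_zero (K := ℝ)
    (fun p : {p : ι × ι // p.1 ≠ p.2} => P p.1.1 - P p.1.2) fun p => sub_ne_zero.2 (hP.ne p.2)
  obtain ⟨z, hz⟩ := (InnerProductSpace.toDual ℝ Plane).surjective ℓ.toContinuousLinearMap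
  have hℓz : ∀ x, ℓ x = ⟪z, x⟫ := fun x => (DFunLike.congr_fun hz x).symm
  have hinj : Function.Injective fun i => ⟪z, P i⟫ := fun i j hij => by
    by_contra hne
    refine hℓ ⟨(i, j), hne⟩ ?_
    rw [hℓz, inner_sub_right, sub_eq_zero]
    exact hij
  rcases eq_or_ne z 0 with rfl | hz0
  · obtain ⟨v, hv⟩ := exists_norm_eq Plane zero_le_one
    exact ⟨v, hv, fun i j _ => hinj (by simp)⟩
  · refine ⟨‖z‖⁻¹ • -J z, by rw [norm_smul, norm_neg, LinearIsometryEquiv.norm_map,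
      norm_inv, norm_norm, inv_mul_cancel₀ (norm_ne_zero_iff.2 hz0)], fun i j hij => hinj ?_⟩
    simpa [hz0] using hij

lemma eq_of_finRotate_invariant {α : Type*} {g : Fin n → α} (h : ∀ i, g (finRotate n i) = g i)
    (i j : Fin n) : g i = g j := by
  cases n with
  | zero => exact i.elim0
  | succ n =>
    have hg : ∀ i, g i = g 0 := fun i => by
      induction i using Fin.induction with
      | zero => rfl
      | succ i ih => rw [← ih, ← h i.castSucc, finRotate_apply, Fin.coeSucc_eq_succ]
    rw [hg i, hg j]

namespace IsPiecewiseConstant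

-- As a line sweeps over the vertex between two edges, the sum of its crossing jumps stays zero,
-- while the jumps of the two edges are exchanged.
lemma edgeJump_finRotate (hf : IsPiecewiseConstant f poly) (hs : poly.IsSimple) (i : Fin n) :
    edgeJump o f poly (finRotate n i) = edgeJump o f poly i := by
  obtain ⟨v, hv, hinj⟩ := exists_norm_eq_one_injective_areaForm o (vertices_injective hs)
  have hsum : ∀ c ∉ range fun i => ω v (poly i),
      ∑ i, (edgeJump o f poly ((finRotate n).symm i) - edgeJump o f poly i) *
        (Ioi (ω v (poly i))).indicator 1 c = 0 := fun c hc => by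
    rw [← hf.sum_crossingSign_mul_edgeJump o hs hv hc]
    simp only [crossingSign, sub_mul, Finset.sum_sub_distrib]
    rw [← Equiv.sum_comp (finRotate n)]
    simp only [Equiv.symm_apply_apply, mul_comm]
  have h := eq_zero_of_sum_indicator_Ioi_eq_zero hinj hsum (finRotate n i)
  rw [Equiv.symm_apply_apply] at h
  exact (sub_eq_zero.1 h).symm

lemma edgeJump_eq (hf : IsPiecewiseConstant f poly) (hs : poly.IsSimple) (i j : Fin n) :
    edgeJump o f poly i = edgeJump o f poly j :=
  eq_of_finRotate_invariant (hf.edgeJump_finRotate o hs) i j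

end IsPiecewiseConstant

end Jumps

section Divergence

open scoped EuclideanSpace RealInnerProductSpace

variable {n : ℕ} {poly : Polygon Plane n} {f φ : Plane → ℝ} {G : Plane → Plane} {N : Set Plane}
  (o : Orientation ℝ Plane (Fin 2)) {v : Plane}

local notation "ω" => o.areaForm
local notation "J" => o.rightAngleRotation

lemma eq_of_forall_norm_eq_one_inner_eq {E : Type*} [NormedAddCommGroup E] [InnerProductSpace ℝ E]
    {x y : E} (h : ∀ u : E, ‖u‖ = 1 → ⟪u, x⟫ = ⟪u, y⟫) : x = y := by
  by_contra hxy
  have hne := sub_ne_zero.2 hxy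
  have hu := h _ (norm_smul_inv_norm (𝕜 := ℝ) hne)
  rw [← sub_eq_zero, ← inner_sub_right, real_inner_smul_left, mul_eq_zero] at hu
  simp [hne] at hu

lemma measurePreserving_smul_add_smul (hv : ‖v‖ = 1) :
    MeasurePreserving fun q : ℝ × ℝ => q.1 • v + q.2 • J v := by
  have hv0 : v ≠ 0 := norm_ne_zero_iff.1 (by simp [hv])
  have horth : Orthonormal ℝ (o.basisRightAngleRotation v hv0) := by
    rw [o.coe_basisRightAngleRotation, orthonormal_vecCons_iff]
    simp [hv]
  set b := (o.basisRightAngleRotation v hv0).toOrthonormalBasis horth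
  have hcoords : (fun q : ℝ × ℝ => q.1 • v + q.2 • J v) =
      b.repr.symm ∘ WithLp.toLp 2 ∘ MeasurableEquiv.finTwoArrow.symm :=
    funext fun q => by simp [b]
  rw [hcoords]
  exact b.measurePreserving_repr_symm.comp
    ((PiLp.volume_preserving_toLp (Fin 2)).comp (volume_preserving_finTwoArrow ℝ).symm)

lemma integral_eq_integral_integral_line {F : Type*} [NormedAddCommGroup F] [NormedSpace ℝ F]
    {g : Plane → F} (hv : ‖v‖ = 1) (hg : Integrable g) :
    ∫ x, g x = ∫ c : ℝ, ∫ s : ℝ, g (s • v + c • J v) := by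
  have hmp := measurePreserving_smul_add_smul o hv
  have hg' := hg.aestronglyMeasurable
  rw [← hmp.map_eq] at hg'
  rw [← integral_prod_symm (fun q : ℝ × ℝ => g (q.1 • v + q.2 • J v))
    (hmp.integrable_comp_of_integrable hg), ← Measure.volume_eq_prod,
    ← integral_map hmp.aemeasurable hg', hmp.map_eq]

lemma continuous_crossingPoint (i : Fin n) : Continuous fun c => crossingPoint o poly v c i :=
  (continuous_edgePath poly i).comp (by unfold crossingParam; fun_prop)

lemma integrable_crossingSign_mul (hφ : Continuous φ) (i : Fin n) :
    Integrable fun c => crossingSign o poly v c i * φ (crossingPoint o poly v c i) :=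
  integrable_indicator_Ioi_sub_mul (hφ.comp (continuous_crossingPoint o i)) _ _

lemma integral_crossingSign_mul (hφ : Continuous φ) (i : Fin n) :
    ∫ c, crossingSign o poly v c i * φ (crossingPoint o poly v c i) =
      -(ω v (edgeVec poly i) * ∫ t in (0 : ℝ)..1, φ (poly.edgePath ℝ i t)) := by
  set k : ℝ → ℝ := fun c => φ (crossingPoint o poly v c i)
  have hk : Continuous k := hφ.comp (continuous_crossingPoint o i)
  rw [← neg_eq_iff_eq_neg]
  refine (congrArg Neg.neg (integral_indicator_Ioi_sub_mul hk _ _)).trans ?_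
  rw [← intervalIntegral.integral_symm]
  rcases eq_or_ne (ω v (edgeVec poly i)) 0 with h0 | h0
  · rw [h0, zero_mul]
    rw [areaForm_edgeVec, sub_eq_zero] at h0
    rw [h0, intervalIntegral.integral_same]
  · have hpath : ∀ t, φ (poly.edgePath ℝ i t) = k (ω v (poly i) + ω v (edgeVec poly i) * t) :=
      fun t => by
        simp only [k]
        rw [crossingPoint, crossingParam, add_sub_cancel_left, mul_div_cancel_left₀ _ h0]
    simp only [hpath]
    rw [intervalIntegral.mul_integral_comp_add_mul, mul_zero, add_zero, mul_one, areaForm_edgeVec,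
      add_sub_cancel]

namespace IsPiecewiseConstant

lemma integral_mul_inner_gradient (hf : IsPiecewiseConstant f poly) (hs : poly.IsSimple)
    (hv : ‖v‖ = 1) (hφ : Continuous φ) (hN : N.Countable)
    (hgrad : ∀ x ∉ N, HasGradientAt φ (G x) x) (hG : ∀ x ∉ N, ContinuousAt G x)
    (hint : Integrable fun x => f x • G x) :
    ∫ x, f x * ⟪v, G x⟫ = ∑ i, edgeJump o f poly i *
      (ω v (edgeVec poly i) * ∫ t in (0 : ℝ)..1, φ (poly.edgePath ℝ i t)) := by
  have hint' : Integrable fun x => f x * ⟪v, G x⟫ := by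
    simpa only [real_inner_smul_right] using hint.const_inner (𝕜 := ℝ) v
  have hexc : (range (fun i => ω v (poly i)) ∪ ω v '' N).Countable :=
    (countable_range _).union (hN.image _)
  have hline : ∀ᵐ c : ℝ, ∫ s : ℝ, f (s • v + c • J v) * ⟪v, G (s • v + c • J v)⟫ =
      -∑ i, edgeJump o f poly i *
        (crossingSign o poly v c i * φ (crossingPoint o poly v c i)) := by
    filter_upwards [compl_mem_ae_iff.2 (hexc.measure_zero volume)] with c hc
    rw [mem_compl_iff, mem_union, not_or] at hc
    have hcN : ∀ s : ℝ, s • v + c • J v ∉ N := fun s h =>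
      hc.2 ⟨_, h, areaForm_smul_add_smul o hv s c⟩
    rw [hf.integral_line_mul_inner_gradient o hs hv hc.1 (fun s => hgrad _ (hcN s))
      fun s => hG _ (hcN s)]
    simp only [mul_assoc, mul_left_comm (edgeJump _ _ _ _)]
  rw [integral_eq_integral_integral_line o hv hint', integral_congr_ae hline, integral_neg,
    integral_finsetSum _ fun i _ => (integrable_crossingSign_mul o hφ i).const_mul _]
  simp only [integral_const_mul, integral_crossingSign_mul o hφ, mul_neg, Finset.sum_neg_distrib,
    neg_neg]

theorem integral_smul_gradient (hf : IsPiecewiseConstant f poly) (hs : poly.IsSimple)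
    (hφ : Continuous φ) (hN : N.Countable)
    (hgrad : ∀ x ∉ N, HasGradientAt φ (G x) x) (hG : ∀ x ∉ N, ContinuousAt G x)
    (hint : Integrable fun x => f x • G x) :
    ∫ x, f x • G x = -J (∑ i,
      (edgeJump o f poly i * ∫ t in (0 : ℝ)..1, φ (poly.edgePath ℝ i t)) • edgeVec poly i) := by
  refine eq_of_forall_norm_eq_one_inner_eq fun v hv => ?_
  rw [← integral_inner hint, inner_neg_right, o.inner_rightAngleRotation_right, neg_neg, map_sum]
  simp only [real_inner_smul_right, map_smul, smul_eq_mul]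
  rw [hf.integral_mul_inner_gradient o hs hv hφ hN hgrad hG hint]
  exact Finset.sum_congr rfl fun i _ => by ring

end IsPiecewiseConstant

end Divergence

section GeometricMedian

open scoped RealInnerProductSpace

section NormedSpace

variable {E : Type*} [NormedAddCommGroup E] [NormedSpace ℝ E]

lemma continuousAt_normalize {x : E} (h : x ≠ 0) : ContinuousAt (NormedSpace.normalize : E → E) x :=
  (continuousAt_id.norm.inv₀ (norm_ne_zero_iff.2 h)).smul continuousAt_id

lemma norm_normalize_le (x : E) : ‖NormedSpace.normalize x‖ ≤ 1 := by
  rw [NormedSpace.normalize, norm_smul, norm_inv, norm_norm]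
  exact inv_mul_le_one

lemma integrable_normalize_sub [MeasurableSpace E] [BorelSpace E]
    [SecondCountableTopology E] {μ : Measure E} [IsFiniteMeasure μ] (m : E) :
    Integrable (fun P => NormedSpace.normalize (P - m)) μ := by
  refine .of_bound (C := 1) ?_ (ae_of_all _ fun P => norm_normalize_le _)
  unfold NormedSpace.normalize
  exact Measurable.aestronglyMeasurable (by fun_prop)

end NormedSpace

variable {E : Type*} [NormedAddCommGroup E] [InnerProductSpace ℝ E] {m x : E}

lemma hasFDerivAt_dist (h : x ≠ m) :
    HasFDerivAt (fun x => dist x m) (innerSL ℝ (NormedSpace.normalize (x - m))) x := by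
  have hne : ‖x - m‖ ≠ 0 := norm_ne_zero_iff.2 (sub_ne_zero.2 h)
  have hsqrt := ((hasFDerivAt_id x).sub_const m).norm_sq.sqrt (pow_ne_zero 2 hne)
  simp only [id, ← dist_eq_norm _ m, Real.sqrt_sq dist_nonneg] at hsqrt
  refine hsqrt.congr_fderiv ?_
  ext z
  simp only [dist_eq_norm, one_div, mul_inv_rev, map_sub, ContinuousLinearMap.comp_id,
    smul_apply, sub_apply, coe_innerSL_apply, nsmul_eq_mul, Nat.cast_ofNat, smul_eq_mul,
    NormedSpace.normalize, map_smul]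
  field_simp

lemma inner_normalize_self (x : E) : ⟪NormedSpace.normalize x, x⟫ = ‖x‖ := by
  rw [NormedSpace.normalize, real_inner_smul_left, real_inner_self_eq_norm_mul_norm,
    ← mul_assoc, inv_mul_mul_self]

lemma dist_le_dist_add_inner_normalize (x m y : E) :
    dist x m ≤ dist x y + ⟪NormedSpace.normalize (x - m), y - m⟫ :=
  calc
    dist x m = ⟪NormedSpace.normalize (x - m), x - y⟫ +
        ⟪NormedSpace.normalize (x - m), y - m⟫ := by
      rw [← inner_add_right, sub_add_sub_cancel, inner_normalize_self, dist_eq_norm]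
    _ ≤ dist x y + ⟪NormedSpace.normalize (x - m), y - m⟫ := by
      rw [dist_eq_norm x y]
      gcongr
      exact (real_inner_le_norm _ _).trans
        (mul_le_of_le_one_left (norm_nonneg _) (norm_normalize_le _))

variable [MeasurableSpace E] [BorelSpace E] [SecondCountableTopology E] {μ : Measure E}
  [IsFiniteMeasure μ]

lemma hasFDerivAt_integral_dist [CompleteSpace E] (hμ : μ {m} = 0)
    (hint : Integrable (fun P => dist P m) μ) :
    HasFDerivAt (fun X => ∫ P, dist P X ∂μ)
      (-innerSL ℝ (∫ P, NormedSpace.normalize (P - m) ∂μ)) m := by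
  have hd : ∀ᵐ P ∂μ, HasFDerivAt (fun X => dist P X)
      (-innerSL ℝ (NormedSpace.normalize (P - m))) m := by
    filter_upwards [compl_mem_ae_iff.2 hμ] with P hP
    rw [← map_neg, ← NormedSpace.normalize_neg, neg_sub]
    simpa only [dist_comm P] using hasFDerivAt_dist (m := P) (Ne.symm hP)
  have hn := integrable_normalize_sub (μ := μ) m
  rw [← ContinuousLinearMap.integral_comp_comm _ hn, ← integral_neg]
  exact (hasFDerivAt_integral_of_dominated_loc_of_lip univ_mem
    (.of_forall fun X => Continuous.aestronglyMeasurable (by fun_prop)) hint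
    ((innerSL ℝ).integrable_comp hn).neg.aestronglyMeasurable
    (ae_of_all _ fun P => by simpa using LipschitzWith.dist_right P)
    (integrable_const 1) hd).2

theorem forall_integral_dist_le_iff [CompleteSpace E] (hμ : μ {m} = 0)
    (hint : ∀ X, Integrable (fun P => dist P X) μ) :
    (∀ X, ∫ P, dist P m ∂μ ≤ ∫ P, dist P X ∂μ) ↔ ∫ P, NormedSpace.normalize (P - m) ∂μ = 0 := by
  constructor
  · intro hmin
    have h := IsLocalMin.hasFDerivAt_eq_zero (.of_forall hmin)
      (hasFDerivAt_integral_dist hμ (hint m))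
    rwa [neg_eq_zero, ← norm_eq_zero, innerSL_apply_norm, norm_eq_zero] at h
  · intro h0 X
    have hn := integrable_normalize_sub (μ := μ) m
    calc ∫ P, dist P m ∂μ ≤ ∫ P, (dist P X + ⟪NormedSpace.normalize (P - m), X - m⟫) ∂μ :=
          integral_mono (hint m) ((hint X).add (hn.inner_const _)) fun P =>
            dist_le_dist_add_inner_normalize P m X
      _ = ∫ P, dist P X ∂μ := by
          rw [integral_add (hint X) (hn.inner_const _)]
          simp_rw [real_inner_comm (X - m)]
          rw [integral_inner hn, h0, inner_zero_right, add_zero]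

end GeometricMedian

section Regions

open scoped EuclideanSpace

variable {n : ℕ} {poly : Polygon Plane n} {Ω : Set Plane}

lemma indicator_one_smul {R M α : Type*} [Semiring R] [AddCommMonoid M] [Module R M] (s : Set α)
    (g : α → M) : (fun x => s.indicator (1 : α → R) x • g x) = s.indicator g := by
  simpa only [Pi.one_apply, one_smul] using (indicator_smul_left s (1 : α → R) g).symm

lemma isPiecewiseConstant_indicator (hb : IsBounded Ω) (hfr : frontier Ω ⊆ poly.boundary ℝ) :
    IsPiecewiseConstant (Ω.indicator 1) poly where
  eventually_eq x hx := by
    have hx : x ∈ (frontier Ω)ᶜ := fun h => hx (hfr h)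
    rw [compl_frontier_eq_union_interior] at hx
    rcases hx with hx | hx
    · filter_upwards [mem_interior_iff_mem_nhds.1 hx] with y hy
      rw [indicator_of_mem hy, indicator_of_mem (interior_subset hx), Pi.one_apply, Pi.one_apply]
    · filter_upwards [mem_interior_iff_mem_nhds.1 hx] with y hy
      rw [indicator_of_notMem hy, indicator_of_notMem (interior_subset hx)]
  eventually_eq_zero := by
    filter_upwards [isBounded_def.1 hb] with x hx
    exact indicator_of_notMem hx 1

lemma exists_ne_zero_forall_edgeJump_eq (o : Orientation ℝ Plane (Fin 2))
    (hΩ : IsPolygonalRegion Ω poly) :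
    ∃ ε ≠ 0, ∀ i, edgeJump o (Ω.indicator 1) poly i = ε := by
  have hf := isPiecewiseConstant_indicator hΩ.bounded hΩ.frontier_eq.le
  suffices ∃ i, edgeJump o (Ω.indicator 1) poly i ≠ 0 by
    obtain ⟨i, hi⟩ := this
    exact ⟨_, hi, fun j => hf.edgeJump_eq o hΩ.simple j i⟩
  by_contra! h0
  obtain ⟨v, hv⟩ := exists_ne (0 : Plane)
  have hfin := hΩ.bounded.measure_lt_top (μ := volume)
  have hint : Integrable fun x => Ω.indicator (1 : Plane → ℝ) x • v := by
    rw [indicator_one_smul, integrable_indicator_iff hΩ.isOpen.measurableSet]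
    exact integrableOn_const hfin.ne
  have hdiv := hf.integral_smul_gradient o hΩ.simple (φ := fun x => inner ℝ v x) (G := fun _ => v)
    (by fun_prop) countable_empty
    (fun x _ => hasGradientAt_iff_hasFDerivAt.2 (innerSL ℝ v).hasFDerivAt) (by fun_prop) hint
  have hvol : volume.real Ω • v = 0 := by
    simpa only [h0, zero_mul, zero_smul, Finset.sum_const_zero, map_zero, neg_zero,
      indicator_one_smul, integral_indicator hΩ.isOpen.measurableSet, setIntegral_const] using hdiv
  have hpos : 0 < volume.real Ω :=
    ENNReal.toReal_pos (hΩ.isOpen.measure_pos volume hΩ.connected.nonempty).ne' hfin.ne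
  exact smul_ne_zero hpos.ne' hv hvol

theorem setIntegral_gradient_eq_zero_iff {φ : Plane → ℝ} {G : Plane → Plane} {N : Set Plane}
    (hΩ : IsPolygonalRegion Ω poly) (hφ : Continuous φ) (hN : N.Countable)
    (hgrad : ∀ x ∉ N, HasGradientAt φ (G x) x) (hG : ∀ x ∉ N, ContinuousAt G x)
    (hint : IntegrableOn G Ω) :
    ∫ x in Ω, G x = 0 ↔
      ∑ i, (∫ t in (0 : ℝ)..1, φ (poly.edgePath ℝ i t)) • edgeVec poly i = 0 := by
  have hΩm := hΩ.isOpen.measurableSet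
  let o : Orientation ℝ Plane (Fin 2) := (EuclideanSpace.basisFun (Fin 2) ℝ).toBasis.orientation
  obtain ⟨ε, hε, hjump⟩ := exists_ne_zero_forall_edgeJump_eq o hΩ
  have hdiv := (isPiecewiseConstant_indicator hΩ.bounded hΩ.frontier_eq.le).integral_smul_gradient
    o hΩ.simple hφ hN hgrad hG (indicator_one_smul (R := ℝ) Ω G ▸ hint.integrable_indicator hΩm)
  rw [indicator_one_smul, integral_indicator hΩm] at hdiv
  rw [hdiv]
  simp only [hjump, mul_smul, ← Finset.smul_sum, neg_eq_zero, map_eq_zero_iff _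
    (LinearIsometryEquiv.injective _), smul_eq_zero, hε, false_or]

lemma isGeometricMedian_iff (hb : IsBounded Ω) (m : Plane) :
    IsGeometricMedian Ω m ↔ ∫ x in Ω, NormedSpace.normalize (x - m) = 0 := by
  have : IsFiniteMeasure (volume.restrict Ω) := isFiniteMeasure_restrict.2 hb.measure_lt_top.ne
  refine forall_integral_dist_le_iff (by simp) fun X => ?_
  have hcont : ContinuousOn (fun P => dist P X) (closure Ω) := by fun_prop
  exact (hcont.integrableOn_compact hb.isCompact_closure).mono_set subset_closure

lemma segmentDistIntegral_div {A B : Plane} (hAB : B ≠ A) (X : Plane) :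
    segmentDistIntegral A B X / dist B A =
      ∫ t in (0 : ℝ)..1, dist (AffineMap.lineMap A B t) X := by
  rw [segmentDistIntegral, intervalIntegral.integral_mul_const, dist_comm A,
    mul_div_cancel_right₀ _ (dist_ne_zero.2 hAB)]

end Regions

end PolygonMedian

open PolygonMedian

theorem proposition3 {n : ℕ} (poly : Polygon Plane n) (Ω : Set Plane)
    (hΩ : IsPolygonalRegion Ω poly) (m : Plane) :
    IsGeometricMedian Ω m ↔
      ∑ i : Fin n,
        (segmentDistIntegral (poly i) (poly (finRotate n i)) m /
            dist (poly (finRotate n i)) (poly i)) •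
          (poly (finRotate n i) - poly i) = 0 := by
  have : IsFiniteMeasure (volume.restrict Ω) :=
    isFiniteMeasure_restrict.2 hΩ.bounded.measure_lt_top.ne
  simp only [segmentDistIntegral_div (sub_ne_zero.1 (edgeVec_ne_zero hΩ.simple _))]
  rw [isGeometricMedian_iff hΩ.bounded]
  exact setIntegral_gradient_eq_zero_iff hΩ (φ := fun x => dist x m) (by fun_prop)
    (Set.countable_singleton m)
    (fun x hx => hasGradientAt_iff_hasFDerivAt.2 (hasFDerivAt_dist hx))
    (fun x hx => ContinuousAt.comp (f := (· - m)) (continuousAt_normalize (sub_ne_zero.2 hx))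
      (by fun_prop))
    (integrable_normalize_sub m)
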